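/- **Setting.** In an online minimization problem $P$, an input $\sigma=(s,x_1,\dots,x_n)$ consists of an initial state $s$ and $n=|\sigma|$ requests, and an output is a sequence of answers $(y_1,\dots,y_n)$, where $y_i$ must be a valid answer given $s,x_1,\dots,x_i,y_1,\dots,y_{i-1}$ (a valid answer always exists). Let $I$ be the set of inputs. Each output has a non-negative real cost; $\mathrm{ALG}(\sigma)$ is the cost of the output of an algorithm $\mathrm{ALG}$ on $\sigma$, and $\mathrm{OPT}(\sigma)$ is the optimal (offline) cost. A deterministic algorithm without advice computes $y_i$ from $s,x_1,\dots,x_i$. A deterministic algorithm with advice computes $y_i$ from $s,x_1,\dots,x_i$ and an infinite bit tape $\varphi(\sigma)$, prepared by an oracle that knows $\sigma$ and read by the algorithm from left to right; it has advice complexity at most $b(n)$ if it reads at most $b(n)$ bits on all inputs of length at most $n$. A randomized algorithm $R$ with advice complexity $b(n)$ is a probability distribution over deterministic algorithms with advice complexity at most $b(n)$. It is $c$-competitive if there is a constant $\alpha$ with $\mathbb E[R(\sigma)]\le c\cdot\mathrm{OPT}(\sigma)+\alpha$ for all $\sigma\in I$; its competitive ratio is the infimum of all such $c$. The repeated problem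 $P^*_\Sigma$ has as inputs all $\sigma^*=(\sigma_1;\dots;\sigma_r)$ with $r\ge 1$ and $\sigma_1,\dots,\sigma_r\in I$ having the same initial state. The rounds are served one after the other; the algorithm knows when a new round begins and remembers all previous rounds. A valid output consists of a valid output of $P$ for each $\sigma_i$, its cost is the sum of their costs, and the optimal cost is $\mathrm{OPT}^*_\Sigma(\sigma^*)$; $|\sigma^*|$ is the total number of requests. The problem $P$ is *$\Sigma$-repeatable* if every input of $P$ has only finitely many valid outputs and there are constants $k_1,k_2,k_3\ge 0$ and a map $g$ from the inputs of $P^*_\Sigma$ to the inputs of $P$ such that, for every $\sigma^*$ with $r$ rounds, $|g(\sigma^*)|\le|\sigma^*|+k_1r$ and $\mathrm{OPT}^*_\Sigma(\sigma^*)\ge\mathrm{OPT}(g(\sigma^*))-k_3r$, and such that for every deterministic $P$-algorithm $\mathrm{ALG}$ without advice there is a deterministic $P^*_\Sigma$-algorithm $\mathrm{ALG}^*$ without advice with $\mathrm{ALG}^*(\sigma^*)\le\mathrm{ALG}(g(\sigma^*))+k_2r$ for every $\sigma^*$ with $r$ rounds. **Theorem.** Let $P$ be a $\Sigma$-repeatable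 online minimization problem and let $c\in\mathbb R$ be a constant. Suppose that for every $\varepsilon>0$ and every $\alpha\in\mathbb R$ there is a probability distribution $p_{\alpha,\varepsilon}$ on $I$ with finite support such that $$\mathbb E_{\sigma\sim p_{\alpha,\varepsilon}}[D(\sigma)]\ \ge\ (c-\varepsilon)\,\mathbb E_{\sigma\sim p_{\alpha,\varepsilon}}[\mathrm{OPT}(\sigma)]+\alpha$$ for every deterministic algorithm $D$ for $P$ without advice. Let $b:\mathbb N\to\mathbb N$ with $b(n)=o(n)$. Then every randomized algorithm for $P$ with advice complexity at most $b(n)$ has competitive ratio at least $c$. -/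

import Mathlib

open MeasureTheory Filter Asymptotics
open scoped NNReal

/-- `ys` is a sequence of answers to the first `ys.length` of the requests `xs` (initial state `s`)
in which each answer is an allowed one. Here `ok s [x₁, …, xᵢ] [y₁, …, yᵢ₋₁] y` says that `y` may be
given as the `i`-th answer. -/
def ValidAnswers {S X Y : Type*} (ok : S → List X → List Y → Y → Prop)
    (s : S) (xs : List X) (ys : List Y) : Prop :=
  ys.length ≤ xs.length ∧
    ∀ (i : ℕ) (hi : i < ys.length), ok s (xs.take (i + 1)) (ys.take i) ys[i]

/-- The sequence of answers `f [x₁], f [x₁, x₂], …, f [x₁, …, xₙ]` given to the requests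
`xs = [x₁, …, xₙ]` by the strategy `f`, which sees the requests that have arrived so far. -/
def onlineOutput {X Y : Type*} (f : List X → Y) (xs : List X) : List Y :=
  (List.range xs.length).map fun i => f (xs.take (i + 1))

/-- An online minimization problem. An input `(s, x₁, …, xₙ)` consists of an initial state and a
finite sequence of requests, and has to be served by answers `y₁, …, yₙ`. -/
structure OnlineProblem where
  /-- initial states -/
  State : Type*
  /-- requests -/
  Request : Type*
  /-- answers -/
  Answer : Type*
  /-- the possible inputs -/
  IsInput : State → List Request → Prop
  /-- `IsAllowed s [x₁, …, xᵢ] [y₁, …, yᵢ₋₁] y`: the value `y` is valid for the `i`-th answer -/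
  IsAllowed : State → List Request → List Answer → Answer → Prop
  /-- whenever an answer has to be given, there is a valid one -/
  exists_allowed : ∀ (s : State) (xs : List Request), IsInput s xs →
    ∀ ys : List Answer, ys.length < xs.length → ValidAnswers IsAllowed s xs ys →
      ∃ y, IsAllowed s (xs.take (ys.length + 1)) ys y
  /-- the non-negative real cost of the output `[y₁, …, yₙ]` on the input `(s, x₁, …, xₙ)` -/
  cost : State → List Request → List Answer → ℝ≥0

namespace OnlineProblem

/-- The set of inputs of the problem. -/
structure Input (P : OnlineProblem) where
  state : P.State
  requests : List P.Request
  isInput : P.IsInput state requests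

/-- The length of an input: the number of its requests. -/
def Input.length {P : OnlineProblem} (σ : P.Input) : ℕ := σ.requests.length

/-- `ys` is a valid output for the input `(s, xs)`. -/
def IsValidOutput (P : OnlineProblem) (s : P.State) (xs : List P.Request) (ys : List P.Answer) :
    Prop :=
  ys.length = xs.length ∧ ValidAnswers P.IsAllowed s xs ys

/-- The optimal offline cost of an input. -/
noncomputable def opt (P : OnlineProblem) (σ : P.Input) : ℝ≥0 :=
  sInf {t | ∃ ys, P.IsValidOutput σ.state σ.requests ys ∧ P.cost σ.state σ.requests ys = t}

/-! ### Algorithms without advice -/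

/-- A deterministic online algorithm without advice: the answer to the last request of
`[x₁, …, xᵢ]` is computed from the initial state and `x₁, …, xᵢ`. On every input the output has to
be valid. -/
structure DetAlgorithm (P : OnlineProblem) where
  answer : P.State → List P.Request → P.Answer
  valid : ∀ σ : P.Input,
    P.IsValidOutput σ.state σ.requests (onlineOutput (answer σ.state) σ.requests)

/-- The cost incurred by a deterministic algorithm on an input. -/
def DetAlgorithm.cost {P : OnlineProblem} (D : P.DetAlgorithm) (σ : P.Input) : ℝ≥0 :=
  P.cost σ.state σ.requests (onlineOutput (D.answer σ.state) σ.requests)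

/-! ### Algorithms with advice -/

/-- A deterministic online algorithm with advice, in the advice-on-tape model, together with its
oracle. The infinite tape is read bit by bit from the left. When the requests `xs` have arrived, the
algorithm has read the first `bitsRead φ s xs` bits of the tape `φ`. What it does up to that moment
is determined by `s`, `xs` and these bits. The oracle writes the tape `tape σ`, which may depend on
the whole input `σ`. -/
structure AdviceAlgorithm (P : OnlineProblem) where
  answer : (ℕ → Bool) → P.State → List P.Request → P.Answer
  bitsRead : (ℕ → Bool) → P.State → List P.Request → ℕ
  bitsRead_mono : ∀ φ s xs x, bitsRead φ s xs ≤ bitsRead φ s (xs ++ [x])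
  congr : ∀ (φ ψ : ℕ → Bool) (s : P.State) (xs : List P.Request),
    (∀ j < bitsRead φ s xs, φ j = ψ j) →
      bitsRead ψ s xs = bitsRead φ s xs ∧ answer ψ s xs = answer φ s xs
  tape : P.Input → ℕ → Bool
  valid : ∀ σ : P.Input,
    P.IsValidOutput σ.state σ.requests (onlineOutput (answer (tape σ) σ.state) σ.requests)

/-- The cost incurred by an algorithm with advice on an input. -/
def AdviceAlgorithm.cost {P : OnlineProblem} (A : P.AdviceAlgorithm) (σ : P.Input) : ℝ≥0 :=
  P.cost σ.state σ.requests (onlineOutput (A.answer (A.tape σ) σ.state) σ.requests)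

/-- The advice complexity is at most `b`: on all inputs of length at most `n`, the algorithm reads
at most `b n` bits of advice. -/
def AdviceAlgorithm.HasAdviceComplexity {P : OnlineProblem} (A : P.AdviceAlgorithm) (b : ℕ → ℕ) :
    Prop :=
  ∀ (n : ℕ) (σ : P.Input), σ.length ≤ n → A.bitsRead (A.tape σ) σ.state σ.requests ≤ b n

/-- A randomized online algorithm with advice complexity at most `b`: a probability distribution
over deterministic online algorithms with advice complexity at most `b`, given as a random
variable whose values are such algorithms. The cost on each input has to be a random variable. -/
structure RandAlgorithm (P : OnlineProblem) (b : ℕ → ℕ) where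
  Ω : Type*
  [measurableSpace : MeasurableSpace Ω]
  μ : Measure Ω
  [isProbabilityMeasure : IsProbabilityMeasure μ]
  alg : Ω → P.AdviceAlgorithm
  adviceComplexity : ∀ ω, (alg ω).HasAdviceComplexity b
  measurable_cost : ∀ σ : P.Input, Measurable fun ω => (alg ω).cost σ

attribute [instance] RandAlgorithm.measurableSpace RandAlgorithm.isProbabilityMeasure

/-- `R` is `c`-competitive: for some constant `α`, the expected cost on every input `σ` is (finite
and) at most `c * OPT(σ) + α`. -/
def RandAlgorithm.IsCompetitive {P : OnlineProblem} {b : ℕ → ℕ} (R : P.RandAlgorithm b) (c : ℝ) :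
    Prop :=
  ∃ α : ℝ, ∀ σ : P.Input,
    Integrable (fun ω => ((R.alg ω).cost σ : ℝ)) R.μ ∧
      (∫ ω, ((R.alg ω).cost σ : ℝ) ∂(R.μ)) ≤ c * (P.opt σ : ℝ) + α

/-- The competitive ratio: the infimum of all `c` such that `R` is `c`-competitive
(infinite if there is none). -/
noncomputable def RandAlgorithm.competitiveRatio {P : OnlineProblem} {b : ℕ → ℕ}
    (R : P.RandAlgorithm b) : EReal :=
  sInf {x : EReal | ∃ c : ℝ, R.IsCompetitive c ∧ x = (c : EReal)}

/-! ### The repeated problem -/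

/-- An input `(σ₁; …; σᵣ)`, `r ≥ 1`, of the repeated problem: `r` inputs with the same initial
state, served one after the other, with a restart before each of them. -/
structure RepeatedInput (P : OnlineProblem) where
  state : P.State
  r : ℕ
  one_le_r : 1 ≤ r
  round : Fin r → List P.Request
  isInput : ∀ i, P.IsInput state (round i)

/-- The total number of requests of an input of the repeated problem. -/
def RepeatedInput.length {P : OnlineProblem} (σ : P.RepeatedInput) : ℕ :=
  ∑ i, (σ.round i).length

/-- The rounds that precede round `i`. -/
def RepeatedInput.history {P : OnlineProblem} (σ : P.RepeatedInput) (i : Fin σ.r) :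
    List (List P.Request) :=
  (List.ofFn σ.round).take i

/-- A valid output of the repeated problem consists of a valid output for each round. -/
def IsValidRepeatedOutput (P : OnlineProblem) (σ : P.RepeatedInput)
    (γ : Fin σ.r → List P.Answer) : Prop :=
  ∀ i, P.IsValidOutput σ.state (σ.round i) (γ i)

/-- The cost of an output of the repeated problem is the sum of the costs of the rounds. -/
def repeatedCost (P : OnlineProblem) (σ : P.RepeatedInput) (γ : Fin σ.r → List P.Answer) : ℝ≥0 :=
  ∑ i, P.cost σ.state (σ.round i) (γ i)

/-- The optimal offline cost in the repeated problem. -/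
noncomputable def repeatedOpt (P : OnlineProblem) (σ : P.RepeatedInput) : ℝ≥0 :=
  sInf {t | ∃ γ, P.IsValidRepeatedOutput σ γ ∧ P.repeatedCost σ γ = t}

/-- The output on `σ` of a strategy for the repeated problem. Each answer is computed from the
initial state, all requests of the previous rounds, and the requests of the current round that have
arrived so far. -/
def repeatedOutput (P : OnlineProblem)
    (answer : P.State → List (List P.Request) → List P.Request → P.Answer)
    (σ : P.RepeatedInput) (i : Fin σ.r) : List P.Answer :=
  onlineOutput (answer σ.state (σ.history i)) (σ.round i)

/-- A deterministic online algorithm without advice for the repeated problem. -/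
structure RepeatedDetAlgorithm (P : OnlineProblem) where
  answer : P.State → List (List P.Request) → List P.Request → P.Answer
  valid : ∀ σ : P.RepeatedInput, P.IsValidRepeatedOutput σ (P.repeatedOutput answer σ)

/-- The cost incurred by a deterministic algorithm for the repeated problem. -/
def RepeatedDetAlgorithm.cost {P : OnlineProblem} (D : P.RepeatedDetAlgorithm)
    (σ : P.RepeatedInput) : ℝ≥0 :=
  P.repeatedCost σ (P.repeatedOutput D.answer σ)

/-! ### Repeatable problems -/

/-- The problem is Σ-repeatable with parameters `(k₁, k₂, k₃)`. -/
def IsSigmaRepeatableWith (P : OnlineProblem) (k₁ k₂ k₃ : ℝ) : Prop :=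
  (∀ σ : P.Input, {ys | P.IsValidOutput σ.state σ.requests ys}.Finite) ∧
  0 ≤ k₁ ∧ 0 ≤ k₂ ∧ 0 ≤ k₃ ∧
  ∃ g : P.RepeatedInput → P.Input,
    (∀ σ, ((g σ).length : ℝ) ≤ (σ.length : ℝ) + k₁ * (σ.r : ℝ)) ∧
    (∀ D : P.DetAlgorithm, ∃ D' : P.RepeatedDetAlgorithm, ∀ σ,
      (D'.cost σ : ℝ) ≤ (D.cost (g σ) : ℝ) + k₂ * (σ.r : ℝ)) ∧
    (∀ σ, (P.opt (g σ) : ℝ) - k₃ * (σ.r : ℝ) ≤ (P.repeatedOpt σ : ℝ))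

/-- The problem is Σ-repeatable. -/
def IsSigmaRepeatable (P : OnlineProblem) : Prop :=
  ∃ k₁ k₂ k₃ : ℝ, P.IsSigmaRepeatableWith k₁ k₂ k₃

/-! ### Input distributions -/

/-- A probability distribution with finite support on the set of inputs. -/
structure FiniteInputDistribution (P : OnlineProblem) where
  prob : P.Input →₀ ℝ≥0
  sum_prob : (prob.sum fun _ w => w) = 1

/-- The expected value of `f σ` when the input `σ` is drawn from the distribution. -/
noncomputable def FiniteInputDistribution.expect {P : OnlineProblem}
    (p : P.FiniteInputDistribution) (f : P.Input → ℝ≥0) : ℝ :=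
  p.prob.sum fun σ w => (w : ℝ) * (f σ : ℝ)

end OnlineProblem

/-! ### Outputs of online strategies -/

section OnlineOutput

variable {X Y : Type*}

/-! Suppose `R` is `d`-competitive with `d < c`. Take first `d ≥ 0` and a finitely supported
distribution with a large surplus. It may be assumed to live on one initial state, since an
algorithm sees the state before answering (`exists_single_state`). Draw `r` independent rounds and
feed them through `g` to `P`. By averaging, some fixed algorithm `A` with advice has expected cost
at most that of `R`.

An algorithm reading at most `B` bits behaves on each input like one of `2 ^ B` algorithms without
advice (`exists_cost_ofStrategy_eq`), and each of these yields an algorithm for the repeated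
problem. Given the history, such an algorithm plays the next round as a plain `P`-algorithm, so its
conditional expected cost there is at least `m`. Hence its exponential moment at `-t` decays like
`exp (-t * m + t ^ 2 * M ^ 2) ^ r` (`sum_mul_exp_neg_cost_le`). Adding up the `2 ^ B` moments and
applying Jensen bounds the expected cost of `A` from below with a loss of only `B * log 2 / t`
(`le_sum_mul_cost`). With `t` fixed and `B = o(r)`, the surplus per round beats all losses.

If the ratio is negative, optimal costs are bounded, and the argument applies with `d = 0`. -/

theorem length_onlineOutput (f : List X → Y) (xs : List X) :
    (onlineOutput f xs).length = xs.length := by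
  simp [onlineOutput]

theorem getElem_onlineOutput (f : List X → Y) (xs : List X) (i : ℕ)
    (hi : i < (onlineOutput f xs).length) :
    (onlineOutput f xs)[i] = f (xs.take (i + 1)) := by
  simp [onlineOutput]

theorem onlineOutput_take (f : List X → Y) (xs : List X) (i : ℕ) :
    onlineOutput f (xs.take i) = (onlineOutput f xs).take i := by
  apply List.ext_getElem
  · simp [length_onlineOutput]
  · intro j h₁ h₂
    simp only [length_onlineOutput, List.length_take] at h₁
    rw [List.getElem_take, getElem_onlineOutput, getElem_onlineOutput, List.take_take]
    congr 2
    omega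

theorem onlineOutput_congr {f g : List X → Y} {xs : List X}
    (h : ∀ i < xs.length, f (xs.take (i + 1)) = g (xs.take (i + 1))) :
    onlineOutput f xs = onlineOutput g xs := by
  unfold onlineOutput
  apply List.map_congr_left
  intro i hi
  exact h i (List.mem_range.1 hi)

/-- Stated for the first `n` answers because the induction in `isValidOutput_repairedAnswer` needs
validity of partial outputs. -/
theorem validAnswers_onlineOutput_iff {S : Type*} (ok : S → List X → List Y → Y → Prop) (s : S)
    (xs : List X) (f : List X → Y) (n : ℕ) (hn : n ≤ xs.length) :
    ValidAnswers ok s xs ((onlineOutput f xs).take n) ↔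
      ∀ i < n, ok s (xs.take (i + 1)) ((onlineOutput f xs).take i) (f (xs.take (i + 1))) := by
  have hl : ((onlineOutput f xs).take n).length = n := by
    simp [length_onlineOutput, hn]
  constructor
  · rintro ⟨-, h⟩ i hi
    have := h i (by omega)
    rwa [List.getElem_take, getElem_onlineOutput, List.take_take, min_eq_left hi.le] at this
  · intro h
    refine ⟨by omega, fun i hi => ?_⟩
    rw [List.getElem_take, getElem_onlineOutput, List.take_take, min_eq_left (by omega)]
    exact h i (by omega)

end OnlineOutput

namespace OnlineProblem

variable {P : OnlineProblem}

theorem isValidOutput_onlineOutput_iff (s : P.State) (xs : List P.Request)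
    (f : List P.Request → P.Answer) :
    P.IsValidOutput s xs (onlineOutput f xs) ↔
      ∀ i < xs.length, P.IsAllowed s (xs.take (i + 1)) ((onlineOutput f xs).take i)
        (f (xs.take (i + 1))) := by
  rw [← validAnswers_onlineOutput_iff P.IsAllowed s xs f xs.length le_rfl,
    List.take_of_length_le (by rw [length_onlineOutput])]
  simp [IsValidOutput, length_onlineOutput]

/-! ### Making a strategy valid -/

open Classical in
/-- The answer `y` if it is allowed, and otherwise any allowed answer. -/
noncomputable def allowedOr (P : OnlineProblem) (s : P.State) (xs : List P.Request)
    (ys : List P.Answer) (y : P.Answer) : P.Answer :=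
  if P.IsAllowed s xs ys y then y
  else if h : ∃ z, P.IsAllowed s xs ys z then h.choose else y

theorem allowedOr_of_isAllowed {s : P.State} {xs : List P.Request} {ys : List P.Answer}
    {y : P.Answer} (h : P.IsAllowed s xs ys y) : P.allowedOr s xs ys y = y :=
  if_pos h

theorem isAllowed_allowedOr {s : P.State} {xs : List P.Request} {ys : List P.Answer}
    (y : P.Answer) (h : ∃ z, P.IsAllowed s xs ys z) :
    P.IsAllowed s xs ys (P.allowedOr s xs ys y) := by
  unfold allowedOr
  split_ifs with h₁
  · exact h₁
  · exact h.choose_spec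

/-- The strategy that follows `f` whenever this is allowed. -/
noncomputable def repairedAnswer (P : OnlineProblem) (s : P.State)
    (f : List P.Request → P.Answer) (xs : List P.Request) : P.Answer :=
  P.allowedOr s xs
    ((List.range (xs.length - 1)).attach.map fun i => repairedAnswer P s f (xs.take (i.1 + 1)))
    (f xs)
termination_by xs.length
decreasing_by
  have := List.mem_range.1 i.2
  simp only [List.length_take]
  omega

/-- The recursive calls reproduce the repaired answers given so far, so a proposed answer is tested
against the actual past, not against the past that `f` alone would have produced. -/
theorem repairedAnswer_take (s : P.State) (f : List P.Request → P.Answer) (xs : List P.Request)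
    (i : ℕ) (hi : i < xs.length) :
    P.repairedAnswer s f (xs.take (i + 1)) =
      P.allowedOr s (xs.take (i + 1)) ((onlineOutput (P.repairedAnswer s f) xs).take i)
        (f (xs.take (i + 1))) := by
  rw [repairedAnswer]
  congr 1
  have hl : (xs.take (i + 1)).length - 1 = i := by
    simp only [List.length_take]
    omega
  rw [hl, ← onlineOutput_take, List.attach_map_val
    (f := fun j => P.repairedAnswer s f ((xs.take (i + 1)).take (j + 1)))]
  unfold onlineOutput
  rw [List.length_take, min_eq_left hi.le]
  apply List.map_congr_left
  intro j hj
  have := List.mem_range.1 hj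
  rw [List.take_take, List.take_take]
  congr 2
  omega

theorem isValidOutput_repairedAnswer (f : List P.Request → P.Answer) (s : P.State)
    (xs : List P.Request) (h : P.IsInput s xs) :
    P.IsValidOutput s xs (onlineOutput (P.repairedAnswer s f) xs) := by
  rw [isValidOutput_onlineOutput_iff]
  intro i
  induction i using Nat.strong_induction_on with
  | _ i ih =>
    intro hi
    rw [repairedAnswer_take s f xs i hi]
    apply isAllowed_allowedOr
    have hl : ((onlineOutput (P.repairedAnswer s f) xs).take i).length = i := by
      simp [length_onlineOutput, hi.le]
    have := P.exists_allowed s xs h ((onlineOutput (P.repairedAnswer s f) xs).take i)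
      (by omega) ((validAnswers_onlineOutput_iff _ _ _ _ _ hi.le).2 fun j hj => ih j hj (by omega))
    rwa [hl] at this

theorem onlineOutput_repairedAnswer {f : List P.Request → P.Answer} {s : P.State}
    {xs : List P.Request} (h : P.IsValidOutput s xs (onlineOutput f xs)) :
    onlineOutput (P.repairedAnswer s f) xs = onlineOutput f xs := by
  rw [isValidOutput_onlineOutput_iff] at h
  have key : ∀ i < xs.length, P.repairedAnswer s f (xs.take (i + 1)) = f (xs.take (i + 1)) := by
    intro i
    induction i using Nat.strong_induction_on with
    | _ i ih =>
      intro hi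
      have : (onlineOutput (P.repairedAnswer s f) xs).take i = (onlineOutput f xs).take i := by
        rw [← onlineOutput_take, ← onlineOutput_take]
        apply onlineOutput_congr
        intro j hj
        rw [List.length_take] at hj
        rw [List.take_take, min_eq_left (by omega)]
        exact ih j (by omega) (by omega)
      rw [repairedAnswer_take s f xs i hi, this]
      exact allowedOr_of_isAllowed (h i hi)
  exact onlineOutput_congr key

/-- The deterministic algorithm that follows the strategy `f` whenever this is allowed. -/
noncomputable def DetAlgorithm.ofStrategy (f : P.State → List P.Request → P.Answer) :
    P.DetAlgorithm where
  answer s := P.repairedAnswer s (f s)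
  valid σ := isValidOutput_repairedAnswer (f σ.state) σ.state σ.requests σ.isInput

theorem DetAlgorithm.cost_ofStrategy {f : P.State → List P.Request → P.Answer} {σ : P.Input}
    (h : P.IsValidOutput σ.state σ.requests (onlineOutput (f σ.state) σ.requests)) :
    (DetAlgorithm.ofStrategy f).cost σ =
      P.cost σ.state σ.requests (onlineOutput (f σ.state) σ.requests) := by
  unfold DetAlgorithm.cost DetAlgorithm.ofStrategy
  simp only
  rw [onlineOutput_repairedAnswer h]

/-! ### Algorithms with advice as families of algorithms without advice -/

/-- The tape that starts with the given bits and continues with zeros. -/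
def paddedTape {B : ℕ} (β : Fin B → Bool) (j : ℕ) : Bool :=
  if h : j < B then β ⟨j, h⟩ else false

theorem AdviceAlgorithm.bitsRead_take_le (A : P.AdviceAlgorithm) (φ : ℕ → Bool) (s : P.State)
    (xs : List P.Request) (i : ℕ) : A.bitsRead φ s (xs.take i) ≤ A.bitsRead φ s xs := by
  have : ∀ zs ys : List P.Request, A.bitsRead φ s ys ≤ A.bitsRead φ s (ys ++ zs) := by
    intro zs
    induction zs with
    | nil => intro ys; simp
    | cons z zs ih =>
      intro ys
      refine (A.bitsRead_mono φ s ys z).trans ((ih (ys ++ [z])).trans_eq ?_)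
      simp
  calc _ ≤ A.bitsRead φ s (xs.take i ++ xs.drop i) := this _ _
    _ = _ := by rw [List.take_append_drop]

/-- All bits read on `σ`, also at earlier requests by monotonicity, are among the first `B`, so
padding the truncated tape changes no answer. Repair is needed because a fixed `β` may give invalid
outputs on other inputs; on `σ` it has no effect. -/
theorem AdviceAlgorithm.exists_cost_ofStrategy_eq (A : P.AdviceAlgorithm) {B : ℕ} (σ : P.Input)
    (hB : A.bitsRead (A.tape σ) σ.state σ.requests ≤ B) :
    ∃ β : Fin B → Bool,
      (DetAlgorithm.ofStrategy (A.answer (paddedTape β))).cost σ = A.cost σ := by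
  refine ⟨fun j => A.tape σ j, ?_⟩
  have h : onlineOutput (A.answer (paddedTape fun j : Fin B => A.tape σ j) σ.state) σ.requests =
      onlineOutput (A.answer (A.tape σ) σ.state) σ.requests := by
    apply onlineOutput_congr
    intro i _
    refine (A.congr _ _ _ _ fun j hj => ?_).2
    have := A.bitsRead_take_le (A.tape σ) σ.state σ.requests (i + 1)
    simp [paddedTape, show j < B by omega]
  rw [DetAlgorithm.cost_ofStrategy (by rw [h]; exact A.valid σ), h]
  rfl

/-! ### One round of the repeated problem -/

/-- The rounds `l ++ [xs]` form an input of the repeated problem whose last round has history `l`.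
-/
theorem RepeatedDetAlgorithm.isValidOutput_round (D : P.RepeatedDetAlgorithm) {s : P.State}
    {l : List (List P.Request)} (hl : ∀ y ∈ l, P.IsInput s y) {xs : List P.Request}
    (hx : P.IsInput s xs) :
    P.IsValidOutput s xs (onlineOutput (D.answer s l) xs) := by
  let σ : P.RepeatedInput :=
    { state := s
      r := (l ++ [xs]).length
      one_le_r := by simp
      round := (l ++ [xs]).get
      isInput := by
        intro i
        have := List.get_mem (l ++ [xs]) i
        rcases List.mem_append.1 this with h | h
        · exact hl _ h
        · rw [List.mem_singleton.1 h]; exact hx }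
  have h := D.valid σ ⟨l.length, by simp [σ]⟩
  have h₁ : σ.history ⟨l.length, by simp [σ]⟩ = l := by
    unfold RepeatedInput.history
    simp only [σ]
    rw [List.ofFn_get]
    simp
  have h₂ : σ.round ⟨l.length, by simp [σ]⟩ = xs := by simp [σ]
  unfold repeatedOutput at h
  rwa [h₁, h₂] at h

/-- Freezing the history turns a round into a run of a `P`-algorithm, so hardness applies
conditionally on the past. Repair handles states for which `l` is not a legal history. -/
theorem RepeatedDetAlgorithm.exists_detAlgorithm (D : P.RepeatedDetAlgorithm) {s : P.State}
    {l : List (List P.Request)} (hl : ∀ y ∈ l, P.IsInput s y) :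
    ∃ E : P.DetAlgorithm, ∀ (xs : List P.Request) (hx : P.IsInput s xs),
      E.cost ⟨s, xs, hx⟩ = P.cost s xs (onlineOutput (D.answer s l) xs) :=
  ⟨DetAlgorithm.ofStrategy fun s' => D.answer s' l, fun _ hx =>
    DetAlgorithm.cost_ofStrategy (D.isValidOutput_round hl hx)⟩

/-! ### Optimal costs -/

/-- Finitely many outputs make the infimum a minimum; `D` only witnesses that some valid output
exists. -/
theorem exists_cost_eq_opt (D : P.DetAlgorithm) (σ : P.Input)
    (h : {ys | P.IsValidOutput σ.state σ.requests ys}.Finite) :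
    ∃ ys, P.IsValidOutput σ.state σ.requests ys ∧
      P.cost σ.state σ.requests ys = P.opt σ := by
  apply Set.Nonempty.csInf_mem
    (s := {t | ∃ ys, P.IsValidOutput σ.state σ.requests ys ∧ P.cost σ.state σ.requests ys = t})
  · exact ⟨_, _, D.valid σ, rfl⟩
  · exact h.image _

theorem repeatedOpt_le_sum_opt (D : P.DetAlgorithm)
    (h : ∀ σ : P.Input, {ys | P.IsValidOutput σ.state σ.requests ys}.Finite)
    (σ : P.RepeatedInput) :
    P.repeatedOpt σ ≤ ∑ i, P.opt ⟨σ.state, σ.round i, σ.isInput i⟩ := by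
  choose γ hγ hc using fun i => exists_cost_eq_opt D ⟨σ.state, σ.round i, σ.isInput i⟩ (h _)
  refine csInf_le (OrderBot.bddBelow _) ⟨γ, hγ, ?_⟩
  exact Finset.sum_congr rfl fun i _ => hc i

end OnlineProblem

/-! ### Sums over sequences -/

section Sequences

variable {ι : Type*} [Fintype ι]

theorem sum_fin_succ_fun {M : Type*} [AddCommMonoid M] {r : ℕ} (F : (Fin (r + 1) → ι) → M) :
    ∑ v, F v = ∑ a : ι, ∑ v : Fin r → ι, F (Fin.cons a v) := by
  rw [← (Fin.consEquiv fun _ : Fin (r + 1) => ι).sum_comp, Fintype.sum_prod_type]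
  rfl

/-- A supermartingale bound: whatever the history, one more round contributes a factor of at most
`q`. Peeling off the first round leaves the same situation with `a` prepended to every history. -/
theorem sum_prod_history_le (r : ℕ) {q : ℝ} (hq : 0 ≤ q) (F : List ι → ι → ℝ)
    (hF : ∀ h j, 0 ≤ F h j) (hs : ∀ h, ∑ j, F h j ≤ q) :
    ∑ v : Fin r → ι, ∏ i : Fin r, F ((List.ofFn v).take i) (v i) ≤ q ^ r := by
  induction r generalizing F with
  | zero => simp
  | succ r ih =>
    rw [sum_fin_succ_fun]
    calc _ = ∑ a, F [] a * ∑ v : Fin r → ι, ∏ i : Fin r, F (a :: (List.ofFn v).take i) (v i) := by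
          refine Finset.sum_congr rfl fun a _ => ?_
          rw [Finset.mul_sum]
          refine Finset.sum_congr rfl fun v _ => ?_
          rw [Fin.prod_univ_succ]
          simp [List.ofFn_succ]
      _ ≤ ∑ a, F [] a * q ^ r := by
          gcongr with a
          · exact hF _ _
          · exact ih (fun h j => F (a :: h) j) (fun _ _ => hF _ _) fun _ => hs _
      _ ≤ q ^ (r + 1) := by
          rw [← Finset.sum_mul, pow_succ, mul_comm (q ^ r)]
          gcongr
          exact hs _

theorem sum_prod_weights (r : ℕ) (w : ι → ℝ) (hw : ∑ j, w j = 1) :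
    ∑ v : Fin r → ι, ∏ i, w (v i) = 1 := by
  induction r with
  | zero => simp
  | succ r ih =>
    rw [sum_fin_succ_fun]
    simp [Fin.prod_univ_succ, ← Finset.mul_sum, ih, hw]

theorem sum_prod_weights_mul_sum (r : ℕ) (w h : ι → ℝ) (hw : ∑ j, w j = 1) :
    ∑ v : Fin r → ι, (∏ i, w (v i)) * ∑ i, h (v i) = r * ∑ j, w j * h j := by
  induction r with
  | zero => simp
  | succ r ih =>
    rw [sum_fin_succ_fun]
    calc _ = ∑ a, (w a * h a * ∑ v : Fin r → ι, ∏ i, w (v i) +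
          w a * ∑ v : Fin r → ι, (∏ i, w (v i)) * ∑ i, h (v i)) := by
          refine Finset.sum_congr rfl fun a _ => ?_
          rw [Finset.mul_sum, Finset.mul_sum, ← Finset.sum_add_distrib]
          refine Finset.sum_congr rfl fun v _ => ?_
          rw [Fin.prod_univ_succ, Fin.sum_univ_succ]
          simp only [Fin.cons_zero, Fin.cons_succ]
          ring
      _ = _ := by
          rw [ih, sum_prod_weights r w hw, Finset.sum_add_distrib, ← Finset.sum_mul,
            ← Finset.sum_mul, hw]
          push_cast
          ring

/-- A one-sided second-order bound for the exponential moment. -/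
theorem sum_mul_exp_neg_le {w X : ι → ℝ} (hw₀ : ∀ j, 0 ≤ w j) (hw : ∑ j, w j = 1)
    {t M m : ℝ} (ht : 0 ≤ t) (hX₀ : ∀ j, 0 ≤ X j) (hX : ∀ j, X j ≤ M)
    (hm : m ≤ ∑ j, w j * X j) (htM : t * M ≤ 1) :
    ∑ j, w j * Real.exp (-(t * X j)) ≤ Real.exp (-(t * m) + t ^ 2 * M ^ 2) := by
  calc _ ≤ ∑ j, w j * (1 - t * X j + t ^ 2 * M ^ 2) := by
        gcongr with j
        · exact hw₀ j
        · have h₁ : 0 ≤ t * X j := mul_nonneg ht (hX₀ j)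
          have h₂ : t * X j ≤ t * M := by gcongr; exact hX j
          -- `|exp y - 1 - y| ≤ y ^ 2` for `|y| ≤ 1`, at `y = -(t * X j)`.
          have h₃ := (abs_le.1 (Real.abs_exp_sub_one_sub_id_le (x := -(t * X j))
            (by rw [abs_neg, abs_of_nonneg h₁]; linarith))).2
          have h₄ : (t * X j) ^ 2 ≤ (t * M) ^ 2 := by gcongr
          nlinarith
    _ = 1 - t * ∑ j, w j * X j + t ^ 2 * M ^ 2 := by
        simp only [mul_add, mul_sub, Finset.sum_add_distrib, Finset.sum_sub_distrib, mul_one,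
          ← Finset.sum_mul, hw, one_mul, Finset.mul_sum]
        congr 2
        exact Finset.sum_congr rfl fun j _ => by ring
    _ ≤ -(t * m) + t ^ 2 * M ^ 2 + 1 := by
        have := mul_le_mul_of_nonneg_left hm ht
        linarith
    _ ≤ _ := Real.add_one_le_exp _

end Sequences

namespace OnlineProblem

variable {P : OnlineProblem}

/-! ### Independent rounds -/

section Rounds

variable {ι : Type*} {s : P.State} {x : ι → List P.Request}

/-- The input of the repeated problem whose rounds are given by a sequence of indices. -/
def repeatedInputOf (hx : ∀ j, P.IsInput s (x j)) {r : ℕ} (hr : 1 ≤ r) (v : Fin r → ι) :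
    P.RepeatedInput :=
  ⟨s, r, hr, fun i => x (v i), fun i => hx (v i)⟩

theorem RepeatedDetAlgorithm.cost_repeatedInputOf (D : P.RepeatedDetAlgorithm)
    (hx : ∀ j, P.IsInput s (x j)) {r : ℕ} (hr : 1 ≤ r) (v : Fin r → ι) :
    D.cost (repeatedInputOf hx hr v) =
      ∑ i, P.cost s (x (v i))
        (onlineOutput (D.answer s (((List.ofFn v).take i).map x)) (x (v i))) := by
  unfold RepeatedDetAlgorithm.cost repeatedCost repeatedOutput RepeatedInput.history
  simp only [repeatedInputOf, List.map_take, List.map_ofFn]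
  rfl

variable [Fintype ι]

/-- The exponential of a sum of round costs is a product of history-dependent factors, and each
conditional factor obeys the one-round moment bound. -/
theorem RepeatedDetAlgorithm.sum_mul_exp_neg_cost_le (D : P.RepeatedDetAlgorithm)
    (hx : ∀ j, P.IsInput s (x j)) {w : ι → ℝ} (hw₀ : ∀ j, 0 ≤ w j) (hw : ∑ j, w j = 1)
    {t M m : ℝ} (ht : 0 ≤ t) (htM : t * M ≤ 1)
    (hM : ∀ j ys, P.IsValidOutput s (x j) ys → (P.cost s (x j) ys : ℝ) ≤ M)
    (hm : ∀ E : P.DetAlgorithm, m ≤ ∑ j, w j * (E.cost ⟨s, x j, hx j⟩ : ℝ))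
    {r : ℕ} (hr : 1 ≤ r) :
    ∑ v : Fin r → ι, (∏ i, w (v i)) * Real.exp (-(t * D.cost (repeatedInputOf hx hr v))) ≤
      Real.exp (-(t * m) + t ^ 2 * M ^ 2) ^ r := by
  have hl : ∀ h : List ι, ∀ y ∈ h.map x, P.IsInput s y := by
    intro h y hy
    obtain ⟨j, -, rfl⟩ := List.mem_map.1 hy
    exact hx j
  let X : List ι → ι → ℝ := fun h j =>
    P.cost s (x j) (onlineOutput (D.answer s (h.map x)) (x j))
  refine le_trans (le_of_eq ?_) (sum_prod_history_le r (Real.exp_pos _).le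
    (fun h j => w j * Real.exp (-(t * X h j)))
    (fun h j => mul_nonneg (hw₀ j) (Real.exp_pos _).le) fun h => ?_)
  · refine Finset.sum_congr rfl fun v _ => ?_
    rw [Finset.prod_mul_distrib, ← Real.exp_sum, D.cost_repeatedInputOf hx hr v]
    push_cast
    rw [Finset.mul_sum, Finset.sum_neg_distrib]
  · refine sum_mul_exp_neg_le hw₀ hw ht (fun j => NNReal.coe_nonneg _)
      (fun j => hM j _ (D.isValidOutput_round (hl h) (hx j))) ?_ htM
    obtain ⟨E, hE⟩ := D.exists_detAlgorithm (hl h)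
    refine (hm E).trans_eq (Finset.sum_congr rfl fun j _ => ?_)
    rw [hE]

/-- A lower bound for the expected cost of an algorithm that reads at most `B` bits of advice on
the inputs that correspond to `r` independent rounds. -/
theorem AdviceAlgorithm.le_sum_mul_cost (A : P.AdviceAlgorithm)
    (hx : ∀ j, P.IsInput s (x j)) {w : ι → ℝ} (hw₀ : ∀ j, 0 ≤ w j) (hw : ∑ j, w j = 1)
    {t M m k : ℝ} (ht : 0 < t) (htM : t * M ≤ 1)
    (hM : ∀ j ys, P.IsValidOutput s (x j) ys → (P.cost s (x j) ys : ℝ) ≤ M)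
    (hm : ∀ E : P.DetAlgorithm, m ≤ ∑ j, w j * (E.cost ⟨s, x j, hx j⟩ : ℝ))
    (g : P.RepeatedInput → P.Input)
    (hg : ∀ D : P.DetAlgorithm, ∃ D' : P.RepeatedDetAlgorithm, ∀ σ,
      (D'.cost σ : ℝ) ≤ (D.cost (g σ) : ℝ) + k * (σ.r : ℝ))
    {r : ℕ} (hr : 1 ≤ r) {B : ℕ}
    (hB : ∀ v : Fin r → ι, A.bitsRead (A.tape (g (repeatedInputOf hx hr v)))
      (g (repeatedInputOf hx hr v)).state (g (repeatedInputOf hx hr v)).requests ≤ B) :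
    r * (m - t * M ^ 2 - k) - B * Real.log 2 / t ≤
      ∑ v : Fin r → ι, (∏ i, w (v i)) * (A.cost (g (repeatedInputOf hx hr v)) : ℝ) := by
  choose D' hD' using fun β : Fin B → Bool =>
    hg (DetAlgorithm.ofStrategy (A.answer (paddedTape β)))
  set W : (Fin r → ι) → ℝ := fun v => ∏ i, w (v i)
  have hW₀ : ∀ v, 0 ≤ W v := fun v => Finset.prod_nonneg fun i _ => hw₀ _
  have hW₁ : ∑ v, W v = 1 := sum_prod_weights r w hw
  set a : (Fin r → ι) → ℝ := fun v => A.cost (g (repeatedInputOf hx hr v))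
  -- The right `β` depends on `v`; summing over all `β` removes this dependence at the price of a
  -- factor `2 ^ B`.
  have h₁ : ∀ v, Real.exp (-(t * (a v + k * r))) ≤
      ∑ β, Real.exp (-(t * (D' β).cost (repeatedInputOf hx hr v))) := by
    intro v
    obtain ⟨β, hβ⟩ := A.exists_cost_ofStrategy_eq _ (hB v)
    refine le_trans ?_ (Finset.single_le_sum
      (f := fun β => Real.exp (-(t * (D' β).cost (repeatedInputOf hx hr v))))
      (fun _ _ => (Real.exp_pos _).le) (Finset.mem_univ β))
    have := hD' β (repeatedInputOf hx hr v)
    rw [hβ] at this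
    have h' := mul_le_mul_of_nonneg_left this ht.le
    exact Real.exp_le_exp.2 (neg_le_neg h')
  have h₂ : ∑ v, W v * Real.exp (-(t * (a v + k * r))) ≤
      2 ^ B * Real.exp (-(t * m) + t ^ 2 * M ^ 2) ^ r := by
    calc _ ≤ ∑ v, W v * ∑ β, Real.exp (-(t * (D' β).cost (repeatedInputOf hx hr v))) := by
          gcongr with v
          · exact hW₀ v
          · exact h₁ v
      _ = ∑ β, ∑ v, W v * Real.exp (-(t * (D' β).cost (repeatedInputOf hx hr v))) := by
          simp only [Finset.mul_sum]
          exact Finset.sum_comm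
      _ ≤ ∑ _β : Fin B → Bool, Real.exp (-(t * m) + t ^ 2 * M ^ 2) ^ r := by
          gcongr with β
          exact (D' β).sum_mul_exp_neg_cost_le hx hw₀ hw ht.le htM hM hm hr
      _ = _ := by simp
  -- Jensen's inequality for `exp`.
  have h₃ : Real.exp (∑ v, W v * (-(t * (a v + k * r)))) ≤
      ∑ v, W v * Real.exp (-(t * (a v + k * r))) := by
    simpa using convexOn_exp.map_sum_le (t := Finset.univ) (w := W)
      (p := fun v => -(t * (a v + k * r))) (fun v _ => hW₀ v) hW₁ fun _ _ => Set.mem_univ _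
  have h₄ : ∑ v, W v * (-(t * (a v + k * r))) = -(t * (∑ v, W v * a v + k * r)) := by
    calc _ = ∑ v, (-t * (W v * a v) + W v * (-(t * (k * r)))) :=
          Finset.sum_congr rfl fun v _ => by ring
      _ = _ := by
          rw [Finset.sum_add_distrib, ← Finset.mul_sum, ← Finset.sum_mul, hW₁]
          ring
  have h₅ : (2 : ℝ) ^ B * Real.exp (-(t * m) + t ^ 2 * M ^ 2) ^ r =
      Real.exp (B * Real.log 2 + r * (-(t * m) + t ^ 2 * M ^ 2)) := by
    rw [← Real.exp_nat_mul, Real.exp_add, mul_comm (B : ℝ), Real.exp_mul (Real.log 2),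
      Real.exp_log two_pos, Real.rpow_natCast]
  have h₆ := Real.exp_le_exp.1 (h₄ ▸ (h₃.trans (h₂.trans_eq h₅)))
  have h₇ : t * (r * (m - t * M ^ 2 - k) - B * Real.log 2 / t) ≤ t * ∑ v, W v * a v := by
    have : t * (r * (m - t * M ^ 2 - k) - B * Real.log 2 / t) =
        t * (r * (m - t * M ^ 2 - k)) - B * Real.log 2 := by
      field_simp
    rw [this]
    linarith
  exact le_of_mul_le_mul_left h₇ ht

end Rounds

/-! ### Distributions on inputs with a common initial state -/

/-- From a distribution that is hard for all deterministic algorithms one obtains such a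
distribution on inputs with a common initial state. -/
theorem FiniteInputDistribution.exists_single_state (p : P.FiniteInputDistribution) {d α : ℝ}
    (hp : ∀ D : P.DetAlgorithm, d * p.expect P.opt + α ≤ p.expect D.cost) :
    ∃ (s : P.State) (T : Finset P.Input) (w : P.Input → ℝ), (∀ σ ∈ T, σ.state = s) ∧
      (∀ σ, 0 ≤ w σ) ∧ ∑ σ ∈ T, w σ = 1 ∧
      ∀ D : P.DetAlgorithm,
        d * ∑ σ ∈ T, w σ * (P.opt σ : ℝ) + α ≤ ∑ σ ∈ T, w σ * (D.cost σ : ℝ) := by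
  classical
  let S : Finset P.State := p.prob.support.image Input.state
  let T : P.State → Finset P.Input := fun s => p.prob.support.filter fun σ => σ.state = s
  have hmaps : ∀ σ ∈ p.prob.support, σ.state ∈ S := fun σ hσ => Finset.mem_image_of_mem _ hσ
  have hsplit : ∀ f : P.Input → ℝ,
      ∑ σ ∈ p.prob.support, f σ = ∑ s ∈ S, ∑ σ ∈ T s, f σ := fun f =>
    (Finset.sum_fiberwise_of_maps_to hmaps f).symm
  have hone : ∑ s ∈ S, ∑ σ ∈ T s, (p.prob σ : ℝ) = 1 := by
    rw [← hsplit]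
    have := p.sum_prob
    rw [Finsupp.sum] at this
    exact_mod_cast this
  -- Otherwise each state has an algorithm violating the bound there; choosing among them by the
  -- initial state gives one algorithm `E` that violates it overall.
  have hex : ∃ s ∈ S, ∀ D : P.DetAlgorithm,
      0 ≤ ∑ σ ∈ T s, (p.prob σ : ℝ) * ((D.cost σ : ℝ) - d * P.opt σ - α) := by
    by_contra! hcon
    have hne : S.Nonempty := by
      by_contra hS
      rw [Finset.not_nonempty_iff_eq_empty] at hS
      simp [hS] at hone
    have : Nonempty P.DetAlgorithm := (hcon _ hne.choose_spec).nonempty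
    choose! D hD using hcon
    let E : P.DetAlgorithm := ⟨fun s => (D s).answer s, fun σ => (D σ.state).valid σ⟩
    have hE : ∀ s, ∀ σ ∈ T s, E.cost σ = (D s).cost σ := by
      intro s σ hσ
      have : σ.state = s := (Finset.mem_filter.1 hσ).2
      subst this
      rfl
    have hlt : ∑ s ∈ S, ∑ σ ∈ T s, (p.prob σ : ℝ) * ((E.cost σ : ℝ) - d * P.opt σ - α) < 0 := by
      refine Finset.sum_neg (fun s hs => ?_) hne
      rw [Finset.sum_congr rfl fun σ hσ => by rw [hE s σ hσ]]
      exact hD s hs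
    rw [← hsplit] at hlt hone
    have h := hp E
    unfold FiniteInputDistribution.expect at h
    simp only [Finsupp.sum] at h
    have : ∑ σ ∈ p.prob.support, (p.prob σ : ℝ) * ((E.cost σ : ℝ) - d * P.opt σ - α) =
        ∑ σ ∈ p.prob.support, (p.prob σ : ℝ) * (E.cost σ : ℝ) -
          d * ∑ σ ∈ p.prob.support, (p.prob σ : ℝ) * (P.opt σ : ℝ) - α := by
      calc _ = ∑ σ ∈ p.prob.support, ((p.prob σ : ℝ) * (E.cost σ : ℝ) -
            d * ((p.prob σ : ℝ) * (P.opt σ : ℝ)) - p.prob σ * α) :=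
            Finset.sum_congr rfl fun σ _ => by ring
        _ = _ := by
            rw [Finset.sum_sub_distrib, Finset.sum_sub_distrib, ← Finset.mul_sum,
              ← Finset.sum_mul, hone, one_mul]
    linarith
  obtain ⟨s, hs, h⟩ := hex
  have hpos : 0 < ∑ σ ∈ T s, (p.prob σ : ℝ) := by
    obtain ⟨σ, hσ, rfl⟩ := Finset.mem_image.1 hs
    refine Finset.sum_pos (fun τ hτ => ?_) ⟨σ, Finset.mem_filter.2 ⟨hσ, rfl⟩⟩
    have := Finsupp.mem_support_iff.1 (Finset.mem_filter.1 hτ).1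
    exact NNReal.coe_pos.2 (pos_iff_ne_zero.2 this)
  set q := ∑ σ ∈ T s, (p.prob σ : ℝ) with hq
  refine ⟨s, T s, fun σ => p.prob σ / q, fun σ hσ => (Finset.mem_filter.1 hσ).2,
    fun σ => by positivity, ?_, fun D => ?_⟩
  · rw [← Finset.sum_div, div_self hpos.ne']
  · have h' := h D
    have : ∑ σ ∈ T s, (p.prob σ : ℝ) * ((D.cost σ : ℝ) - d * P.opt σ - α) =
        q * (∑ σ ∈ T s, p.prob σ / q * (D.cost σ : ℝ) -
          (d * ∑ σ ∈ T s, p.prob σ / q * (P.opt σ : ℝ) + α)) := by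
      calc _ = ∑ σ ∈ T s, ((p.prob σ : ℝ) * (D.cost σ : ℝ) -
            d * ((p.prob σ : ℝ) * (P.opt σ : ℝ)) - p.prob σ * α) :=
            Finset.sum_congr rfl fun σ _ => by ring
        _ = ∑ σ ∈ T s, (p.prob σ : ℝ) * (D.cost σ : ℝ) -
              d * ∑ σ ∈ T s, (p.prob σ : ℝ) * (P.opt σ : ℝ) - q * α := by
            rw [Finset.sum_sub_distrib, Finset.sum_sub_distrib, ← Finset.mul_sum,
              ← Finset.sum_mul]
        _ = _ := by
            simp only [div_mul_eq_mul_div, ← Finset.sum_div]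
            field_simp
            ring
    rw [this] at h'
    have := nonneg_of_mul_nonneg_right h' hpos
    linarith

/-! ### The lower bound -/

/-- If for some `d ≥ 0` there are distributions on which every deterministic algorithm exceeds
`d` times the expected optimal cost by an arbitrarily large amount, then sublinear advice does not
help to be `d`-competitive. -/
theorem RandAlgorithm.not_isCompetitive_of_hard (hP : P.IsSigmaRepeatable) {d : ℝ} (hd : 0 ≤ d)
    (hard : ∀ α : ℝ, ∃ p : P.FiniteInputDistribution,
      ∀ D : P.DetAlgorithm, d * p.expect P.opt + α ≤ p.expect D.cost)
    {b : ℕ → ℕ} (hb : (fun n : ℕ => (b n : ℝ)) =o[atTop] fun n : ℕ => (n : ℝ))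
    (R : P.RandAlgorithm b) : ¬ R.IsCompetitive d := by
  rintro ⟨α₀, hα₀⟩
  obtain ⟨k₁, k₂, k₃, hfin, -, -, -, g, hlen, halg, hopt⟩ := hP
  obtain ⟨ω₀⟩ : Nonempty R.Ω := R.μ.nonempty_of_neZero
  have D₀ : P.DetAlgorithm := DetAlgorithm.ofStrategy ((R.alg ω₀).answer fun _ => false)
  -- Surplus per round: `k₂` and `d * k₃` pay for the passage through `g`, `|α₀|` for the additive
  -- constant, and `2` covers `t * M ^ 2 ≤ 1` and advice of at most `1 / 2`, leaving `1 / 2`.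
  obtain ⟨p, hp⟩ := hard (k₂ + d * k₃ + |α₀| + 2)
  obtain ⟨s, T, w, hT, hw₀, hw, hwD⟩ := p.exists_single_state hp
  let x : T → List P.Request := fun j => j.1.requests
  have hx : ∀ j, P.IsInput s (x j) := fun j => by
    have := j.1.isInput
    rwa [hT j.1 j.2] at this
  have hxσ : ∀ j : T, (⟨s, x j, hx j⟩ : P.Input) = j.1 := by
    rintro ⟨⟨s', y, hy⟩, hj⟩
    obtain rfl : s' = s := hT _ hj
    rfl
  have hsum : ∀ f : P.Input → ℝ, ∑ j : T, w j * f ⟨s, x j, hx j⟩ = ∑ σ ∈ T, w σ * f σ := by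
    intro f
    rw [← Finset.sum_coe_sort T fun σ => w σ * f σ]
    exact Finset.sum_congr rfl fun j _ => by rw [hxσ]
  have hw' : ∑ j : T, w j = 1 := by rw [Finset.sum_coe_sort T w, hw]
  obtain ⟨M, hM⟩ : ∃ M : ℝ, ∀ (j : T) (ys), P.IsValidOutput s (x j) ys →
      (P.cost s (x j) ys : ℝ) ≤ M := by
    obtain ⟨M, hM⟩ := (Set.finite_iUnion fun j : T =>
      (hfin ⟨s, x j, hx j⟩).image fun ys => (P.cost s (x j) ys : ℝ)).bddAbove
    exact ⟨M, fun j ys hys => hM (Set.mem_iUnion.2 ⟨j, ys, hys, rfl⟩)⟩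
  obtain ⟨K, hK₀, hK⟩ : ∃ K : ℕ, 0 < K ∧ ∀ j : T, ((x j).length : ℝ) + k₁ ≤ K := by
    refine ⟨T.sup Input.length + ⌈k₁⌉₊ + 1, by omega, fun j => ?_⟩
    have h₁ : ((x j).length : ℝ) ≤ (T.sup Input.length : ℕ) :=
      Nat.cast_le.2 (Finset.le_sup (f := Input.length) j.2)
    have h₂ := Nat.le_ceil k₁
    push_cast
    linarith
  -- Depends on `M` only, so `r` can be chosen afterwards.
  set t : ℝ := 1 / (M ^ 2 + 1) with ht_def
  have ht : 0 < t := by positivity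
  have htM : t * M ≤ 1 := by
    rw [ht_def, one_div_mul_eq_div, div_le_one (by positivity)]
    nlinarith [sq_nonneg (M - 1)]
  have htM2 : t * M ^ 2 ≤ 1 := by
    rw [ht_def, one_div_mul_eq_div, div_le_one (by positivity)]
    linarith
  obtain ⟨r, hr, hrB⟩ : ∃ r : ℕ, 1 ≤ r ∧ (b (K * r) : ℝ) * Real.log 2 / t ≤ r / 2 := by
    have hη : 0 < t / (2 * K) := by positivity
    have hKr : Tendsto (fun r : ℕ => K * r) atTop atTop :=
      tendsto_id.const_mul_atTop' hK₀
    obtain ⟨r, hr₁, hr₂⟩ :=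
      ((hKr.eventually (hb.def hη)).and (eventually_ge_atTop 1)).exists
    refine ⟨r, hr₂, ?_⟩
    rw [Real.norm_natCast, Real.norm_natCast] at hr₁
    rw [div_le_iff₀ ht]
    calc (b (K * r) : ℝ) * Real.log 2 ≤ b (K * r) * 1 := by
          gcongr
          linarith [Real.log_two_lt_d9]
      _ ≤ t / (2 * K) * (K * r : ℕ) := by rw [mul_one]; exact hr₁
      _ = _ := by
          push_cast
          field_simp
  let W : (Fin r → T) → ℝ := fun v => ∏ i, w (v i)
  have hW₀ : ∀ v, 0 ≤ W v := fun v => Finset.prod_nonneg fun i _ => hw₀ _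
  have hW₁ : ∑ v, W v = 1 := sum_prod_weights r (fun j : T => w j) hw'
  let G : (Fin r → T) → P.Input := fun v => g (repeatedInputOf hx hr v)
  have hGlen : ∀ v, (G v).length ≤ K * r := by
    intro v
    have h := hlen (repeatedInputOf hx hr v)
    have h' : ((repeatedInputOf hx hr v).length : ℝ) + k₁ * r ≤ K * r := by
      calc _ = ∑ i : Fin r, (((x (v i)).length : ℝ) + k₁) := by
            simp [RepeatedInput.length, repeatedInputOf, Finset.sum_add_distrib, mul_comm]
            rfl
        _ ≤ ∑ _i : Fin r, (K : ℝ) := Finset.sum_le_sum fun i _ => hK (v i)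
        _ = _ := by simp [mul_comm]
    exact_mod_cast h.trans h'
  have hGopt : ∀ v, (P.opt (G v) : ℝ) ≤ ∑ i, (P.opt ⟨s, x (v i), hx (v i)⟩ : ℝ) + k₃ * r := by
    intro v
    have h₁ := hopt (repeatedInputOf hx hr v)
    have h₂ := repeatedOpt_le_sum_opt D₀ hfin (repeatedInputOf hx hr v)
    have h₃ : (P.repeatedOpt (repeatedInputOf hx hr v) : ℝ) ≤
        ∑ i : Fin r, (P.opt ⟨s, x (v i), hx (v i)⟩ : ℝ) := by exact_mod_cast h₂
    have h₄ : (P.opt (G v) : ℝ) - k₃ * r ≤ P.repeatedOpt (repeatedInputOf hx hr v) := h₁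
    linarith
  have hint : ∀ v, Integrable (fun ω => W v * ((R.alg ω).cost (G v) : ℝ)) R.μ := fun v =>
    (hα₀ (G v)).1.const_mul _
  -- Yao's averaging: some deterministic algorithm with advice does no worse than `R` on the product
  -- distribution.
  obtain ⟨ω, hω⟩ := exists_le_integral (integrable_finsetSum Finset.univ fun v _ => hint v)
  have hlow := (R.alg ω).le_sum_mul_cost hx (fun j => hw₀ j) hw' ht htM hM
    (m := d * ∑ σ ∈ T, w σ * (P.opt σ : ℝ) + (k₂ + d * k₃ + |α₀| + 2))
    (fun E => (hwD E).trans_eq (hsum fun σ => E.cost σ).symm) g halg hr (B := b (K * r))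
    fun v => R.adviceComplexity ω _ _ (hGlen v)
  have hup : ∑ v, W v * ((R.alg ω).cost (G v) : ℝ) ≤
      d * (r * ∑ σ ∈ T, w σ * (P.opt σ : ℝ) + k₃ * r) + α₀ := by
    refine hω.trans ?_
    rw [integral_finsetSum _ fun v _ => hint v]
    calc _ ≤ ∑ v, W v * (d * (∑ i, (P.opt ⟨s, x (v i), hx (v i)⟩ : ℝ) + k₃ * r) + α₀) := by
          refine Finset.sum_le_sum fun v _ => ?_
          rw [integral_const_mul]
          refine mul_le_mul_of_nonneg_left ((hα₀ (G v)).2.trans ?_) (hW₀ v)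
          have := mul_le_mul_of_nonneg_left (hGopt v) hd
          linarith
      _ = ∑ v, (d * (W v * ∑ i, (P.opt ⟨s, x (v i), hx (v i)⟩ : ℝ)) +
            W v * (d * (k₃ * r) + α₀)) := Finset.sum_congr rfl fun v _ => by ring
      _ = _ := by
          rw [Finset.sum_add_distrib, ← Finset.mul_sum, ← Finset.sum_mul, hW₁,
            sum_prod_weights_mul_sum r (fun j : T => w j)
              (fun j => (P.opt ⟨s, x j, hx j⟩ : ℝ)) hw', hsum fun σ => P.opt σ]
          ring
  have hr' : (1 : ℝ) ≤ r := by exact_mod_cast hr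
  have h₁ : (r : ℝ) * (t * M ^ 2) ≤ r * 1 := by gcongr
  have h₂ : α₀ ≤ r * |α₀| := (le_abs_self α₀).trans (by nlinarith [abs_nonneg α₀])
  have h₃ := hlow.trans hup
  nlinarith

/-! ### Reduction to a non-negative ratio -/

theorem RandAlgorithm.IsCompetitive.mono {b : ℕ → ℕ} {R : P.RandAlgorithm b} {c d : ℝ}
    (h : R.IsCompetitive c) (hcd : c ≤ d) : R.IsCompetitive d := by
  obtain ⟨α, hα⟩ := h
  refine ⟨α, fun σ => ⟨(hα σ).1, (hα σ).2.trans ?_⟩⟩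
  gcongr

/-- A negative competitive ratio forces the optimal cost to be bounded. -/
theorem RandAlgorithm.IsCompetitive.exists_opt_le {b : ℕ → ℕ} {R : P.RandAlgorithm b} {c : ℝ}
    (h : R.IsCompetitive c) (hc : c < 0) : ∃ K : ℝ, ∀ σ, (P.opt σ : ℝ) ≤ K := by
  obtain ⟨α, hα⟩ := h
  refine ⟨α / -c, fun σ => ?_⟩
  have h₁ : 0 ≤ ∫ ω, ((R.alg ω).cost σ : ℝ) ∂(R.μ) := integral_nonneg fun _ => NNReal.coe_nonneg _
  rw [le_div_iff₀ (by linarith)]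
  linarith [(hα σ).2]

theorem FiniteInputDistribution.expect_le (p : P.FiniteInputDistribution) {f : P.Input → ℝ≥0}
    {K : ℝ} (hf : ∀ σ, (f σ : ℝ) ≤ K) : p.expect f ≤ K := by
  have h : ∑ σ ∈ p.prob.support, (p.prob σ : ℝ) = 1 := by
    have := p.sum_prob
    rw [Finsupp.sum] at this
    exact_mod_cast this
  calc p.expect f ≤ ∑ σ ∈ p.prob.support, (p.prob σ : ℝ) * K :=
        Finset.sum_le_sum fun σ _ => mul_le_mul_of_nonneg_left (hf σ) (NNReal.coe_nonneg _)
    _ = K := by rw [← Finset.sum_mul, h, one_mul]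

end OnlineProblem

theorem theorem1 (P : OnlineProblem) (hP : P.IsSigmaRepeatable) (c : ℝ)
    (hard : ∀ ε : ℝ, 0 < ε → ∀ α : ℝ, ∃ p : P.FiniteInputDistribution,
      ∀ D : P.DetAlgorithm, (c - ε) * p.expect P.opt + α ≤ p.expect D.cost)
    (b : ℕ → ℕ) (hb : (fun n : ℕ => (b n : ℝ)) =o[atTop] fun n : ℕ => (n : ℝ))
    (R : P.RandAlgorithm b) :
    (c : EReal) ≤ R.competitiveRatio := by
  refine le_sInf ?_
  rintro _ ⟨c', hc', rfl⟩
  rw [EReal.coe_le_coe_iff]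
  by_contra! hlt
  rcases le_or_gt 0 c' with h₀ | h₀
  · refine R.not_isCompetitive_of_hard hP h₀ (fun α => ?_) hb hc'
    simpa using hard (c - c') (by linarith) α
  · refine R.not_isCompetitive_of_hard hP le_rfl (fun α => ?_) hb (hc'.mono h₀.le)
    obtain ⟨K, hK⟩ := hc'.exists_opt_le h₀
    -- As `c' < 0` and optimal costs are at most `K`, the term `c' * p.expect P.opt` is at least `c'
    -- * K`; the shift by `-c' * K` absorbs it.
    obtain ⟨p, hp⟩ := hard (c - c') (by linarith) (α - c' * K)
    refine ⟨p, fun D => le_trans ?_ (hp D)⟩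
    have := mul_le_mul_of_nonpos_left (p.expect_le hK) h₀.le
    rw [sub_sub_cancel]
    linarith
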